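/- **Setting.** A market has $n$ unit-demand buyers, $m$ sellers with one good each, values $v_{ij}\ge 0$, and a bipartite graph $G$ of direct buyer–seller links. For a network $g$, an allocation is feasible if every buyer gets at most one good, every good is sold at most once, and only links of $g$ are used; $W(g)$ is the maximum total value of a feasible allocation. A competitive equilibrium for $g$ consists of prices $p\ge 0$ and a feasible allocation such that every buyer has non-negative utility (value minus price), no buyer $i$ would get strictly higher utility from a good $j$ to which $i$ is linked in $g$, and unsold goods have price $0$. If the set $P$ of sellers joins the platform, the network becomes $G(P)$, in which sellers in $P$ are linked to all buyers and the other links are those of $G$; the price $p_j(P)$ of good $j$ is then its maximum competitive price for $G(P)$. At transaction fee $\alpha\in[0,1]$ seller $j$ obtains $u_j(P,\alpha)=(1-\alpha)p_j(P)$ if $j\in P$ and $u_j(P,\alpha)=p_j(P)$ otherwise, and the platform's revenue is $\alpha\sum_{j\in P}p_j(P)$. A pure platform equilibrium at fee $\alpha$ is a set $P$ from which no seller gains by a unilateral deviation (joining or leaving). A mixed platform equilibrium at fee $\alpha$ is a vector $x\in[0,1]^m$ of independent joining probabilities such that no seller can increase its expected utility by surely joining or surely staying off. An unregulated platform chooses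 the fee $\alpha\in[0,1]$, and an equilibrium at that fee, so as to maximize its (expected) revenue. The *mixed price of anarchy* of a market is the supremum of $W^\star/\mathbb E_{P\sim x}[W(G(P))]$ over all pairs $(\alpha,x)$ that maximize expected revenue among all fees in $[0,1]$ and all mixed equilibria at these fees, where $W^\star$ is the welfare for the complete bipartite graph. The *pure price of anarchy* is the supremum of $W^\star/W(G(P))$ over all pairs $(\alpha,P)$ that maximize revenue among all fees in $[0,1]$ and all pure equilibria at these fees. (Both are taken in $[0,\infty]$, with supremum $0$ over the empty set.) **Proposition.** For all integers $n,m\ge 1$ there is a sequence $(M_k)_{k\in\mathbb N}$ of markets with $n$ buyers and $m$ sellers such that both the pure and the mixed price of anarchy of $M_k$ converge to $\min\{n,m\}$ as $k\to\infty$. -/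

import Mathlib

open Filter Topology
open scoped ENNReal

noncomputable section

/-- A buyer-seller network with `n` unit-demand buyers and `m` single-item sellers:
`value i j` is the value of buyer `i` for the good of seller `j`, and `link i j` says that
buyer `i` can transact directly (off the platform) with seller `j`. -/
structure Market (n m : ℕ) where
  value : Fin n → Fin m → ℝ
  value_nonneg : ∀ i j, 0 ≤ value i j
  link : Fin n → Fin m → Prop

namespace Market

variable {n m : ℕ}

/-- The network `G(P)` once the sellers in `P` have joined the platform: a seller on the platform
can transact with every buyer, the links of the other sellers are unchanged. -/
def linkWith (M : Market n m) (P : Finset (Fin m)) (i : Fin n) (j : Fin m) : Prop :=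
  j ∈ P ∨ M.link i j

/-- An allocation assigns at most one good to every buyer. It is feasible for the network `g` if it
uses only links of `g` and sells no good twice. -/
def Feasible (g : Fin n → Fin m → Prop) (a : Fin n → Option (Fin m)) : Prop :=
  (∀ i j, a i = some j → g i j) ∧
    ∀ i i' j, a i = some j → a i' = some j → i = i'

/-- The value that buyer `i` gets from the good allocated to her, and `0` without a good. -/
def allocValue (M : Market n m) (a : Fin n → Option (Fin m)) (i : Fin n) : ℝ :=
  (a i).elim 0 fun j => M.value i j

/-- Quasi-linear utility of buyer `i` at prices `p` and allocation `a`. -/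
def buyerUtility (M : Market n m) (p : Fin m → ℝ) (a : Fin n → Option (Fin m)) (i : Fin n) : ℝ :=
  (a i).elim 0 fun j => M.value i j - p j

/-- `W(S, B, v, g)`: the largest total value of an allocation that is feasible for `g`
(a maximum over a finite, nonempty set). -/
def welfare (M : Market n m) (g : Fin n → Fin m → Prop) : ℝ :=
  sSup {w | ∃ a, Feasible g a ∧ w = ∑ i, M.allocValue a i}

/-- The welfare of the unconstrained market, in which each buyer can transact with each seller. -/
def optimalWelfare (M : Market n m) : ℝ :=
  M.welfare fun _ _ => True

/-- Competitive (Walrasian) equilibrium `(p, a)` for the network `g`. -/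
structure IsCompetitiveEquilibrium (M : Market n m) (g : Fin n → Fin m → Prop)
    (p : Fin m → ℝ) (a : Fin n → Option (Fin m)) : Prop where
  price_nonneg : ∀ j, 0 ≤ p j
  feasible : Feasible g a
  best : ∀ i j, g i j → M.value i j - p j ≤ M.buyerUtility p a i
  utility_nonneg : ∀ i, 0 ≤ M.buyerUtility p a i
  unsold : ∀ j, (∀ i, a i ≠ some j) → p j = 0

/-- Competitive prices: prices that are part of some competitive equilibrium. -/
def IsCompetitivePrice (M : Market n m) (g : Fin n → Fin m → Prop) (p : Fin m → ℝ) : Prop :=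
  ∃ a, M.IsCompetitiveEquilibrium g p a

/-- The maximum competitive price of good `j` once the sellers in `P` have joined. -/
def price (M : Market n m) (P : Finset (Fin m)) (j : Fin m) : ℝ :=
  sSup {t | ∃ p, M.IsCompetitivePrice (M.linkWith P) p ∧ t = p j}

/-- Utility of seller `j` at transaction fee `α` when exactly the sellers in `P` join. -/
def sellerUtility (M : Market n m) (α : ℝ) (P : Finset (Fin m)) (j : Fin m) : ℝ :=
  if j ∈ P then (1 - α) * M.price P j else M.price P j

/-- Revenue of the platform at transaction fee `α` when exactly the sellers in `P` join. -/
def revenue (M : Market n m) (α : ℝ) (P : Finset (Fin m)) : ℝ :=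
  α * ∑ j ∈ P, M.price P j

/-- Expectation of `f P` when each seller `j` joins `P` independently with probability `x j`. -/
def expect (x : Fin m → ℝ) (f : Finset (Fin m) → ℝ) : ℝ :=
  ∑ P : Finset (Fin m), ((∏ j ∈ P, x j) * ∏ j ∈ Pᶜ, (1 - x j)) * f P

/-- `P` is a pure platform equilibrium at transaction fee `α`. -/
def IsPureEquilibrium (M : Market n m) (α : ℝ) (P : Finset (Fin m)) : Prop :=
  (∀ j ∈ P, M.price (P.erase j) j ≤ (1 - α) * M.price P j) ∧
    ∀ j, j ∉ P → (1 - α) * M.price (insert j P) j ≤ M.price P j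

/-- `x` is a (mixed) platform equilibrium at transaction fee `α`, where `x j` is the probability
with which seller `j` joins. In `Function.update x j 0` seller `j` stays off the platform. -/
def IsMixedEquilibrium (M : Market n m) (α : ℝ) (x : Fin m → ℝ) : Prop :=
  (∀ j, x j ∈ Set.Icc (0 : ℝ) 1) ∧
    ∀ j, max
        (expect (Function.update x j 0) fun P => M.sellerUtility α P j)
        (expect (Function.update x j 0) fun P => M.sellerUtility α (insert j P) j)
      ≤ expect x fun P => M.sellerUtility α P j

/-- The fee `α` and the pure equilibrium `P` at `α` maximize the revenue of the unregulated
platform over all fees in `[0, 1]` and all pure equilibria at that fee. -/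
def IsPureOptimal (M : Market n m) (α : ℝ) (P : Finset (Fin m)) : Prop :=
  α ∈ Set.Icc (0 : ℝ) 1 ∧ M.IsPureEquilibrium α P ∧
    ∀ β ∈ Set.Icc (0 : ℝ) 1, ∀ Q, M.IsPureEquilibrium β Q → M.revenue β Q ≤ M.revenue α P

/-- The fee `α` and the mixed equilibrium `x` at `α` maximize the expected revenue of the
unregulated platform over all fees in `[0, 1]` and all mixed equilibria at that fee. -/
def IsMixedOptimal (M : Market n m) (α : ℝ) (x : Fin m → ℝ) : Prop :=
  α ∈ Set.Icc (0 : ℝ) 1 ∧ M.IsMixedEquilibrium α x ∧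
    ∀ β ∈ Set.Icc (0 : ℝ) 1, ∀ y, M.IsMixedEquilibrium β y →
      expect y (M.revenue β) ≤ expect x (M.revenue α)

/-- Price of anarchy of the market `M` for pure platform equilibria: the worst ratio of the optimal
welfare to the welfare of a revenue-maximizing pure equilibrium. The value in `ℝ≥0∞` is `∞` if such
an equilibrium loses all of a positive optimal welfare. -/
def purePoA (M : Market n m) : ℝ≥0∞ :=
  ⨆ (α : ℝ) (P : Finset (Fin m)) (_ : M.IsPureOptimal α P),
    ENNReal.ofReal M.optimalWelfare / ENNReal.ofReal (M.welfare (M.linkWith P))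

/-- Price of anarchy of the market `M` for all (mixed) platform equilibria. -/
def mixedPoA (M : Market n m) : ℝ≥0∞ :=
  ⨆ (α : ℝ) (x : Fin m → ℝ) (_ : M.IsMixedOptimal α x),
    ENNReal.ofReal M.optimalWelfare /
      ENNReal.ofReal (expect x fun P => M.welfare (M.linkWith P))

end Market

end

/-! Let `r = min n m`. In the ladder market buyer 0 values the goods `0, …, r - 1` at about `1, 2,
…, r`, with consecutive values `step = 1 - r * ε` apart; all other values are at most `ε`. The
optimal welfare is therefore about `r`. Seller 0 has no direct link. At fee 1, seller 0 alone on the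
platform is an equilibrium: joining pays nothing, but staying off pays seller 0 nothing either. The
platform then earns 1 and the welfare is about 1.

The point is that every other way of using the platform earns less. Suppose that `k ≥ 1` is the
highest rung joining with positive probability. Off the platform seller `k` can always get `δ k`
from buyer `k`, so the fee must leave `1 - α ≥ δ k / r`. For a lower seller `j` this already makes
joining strictly better: the on-platform price is at least `ε / 2` because of buyer `j + 1`, and the
outside option `δ j` is far smaller than `ε * δ k / r`. So all lower sellers join surely
(`eq_one_of_highest`). They compete for buyer 0: the highest one present gets at most `step + ε` (or
1 if it is seller 0), the others at most `ε`, so prices sum to at most `r * ε + step = 1`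
(`sum_price_le_one`). As `α < 1`, revenue stays below 1.

Hence the optimal equilibria, pure or mixed, have seller 0 as the only ladder seller on the platform
(`mixed_revenue`), and both prices of anarchy tend to `r` as `ε → 0`. -/

namespace Market

/-! ### Competitive prices and welfare in an arbitrary market -/

variable {n m : ℕ}

/-- Giving the sales as a relation `R` and the buyer utilities as a separate vector `u` lets an
equilibrium be checked by cases, without handling `Option`-valued allocations. -/
lemma isCompetitivePrice_of_matching (M : Market n m) (g R : Fin n → Fin m → Prop)
    (p : Fin m → ℝ) (u : Fin n → ℝ) (hp : ∀ j, 0 ≤ p j) (hRg : ∀ i j, R i j → g i j)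
    (hfun : ∀ i j j', R i j → R i j' → j = j') (hinj : ∀ i i' j, R i j → R i' j → i = i')
    (hu : ∀ i j, R i j → u i = M.value i j - p j) (hu' : ∀ i, (∀ j, ¬ R i j) → u i = 0)
    (hu0 : ∀ i, 0 ≤ u i) (hbest : ∀ i j, g i j → M.value i j - p j ≤ u i)
    (hunsold : ∀ j, (∀ i, ¬ R i j) → p j = 0) : M.IsCompetitivePrice g p := by
  classical
  let a : Fin n → Option (Fin m) := fun i => if h : ∃ j, R i j then some h.choose else none
  have ha : ∀ i j, a i = some j ↔ R i j := by
    intro i j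
    by_cases h : ∃ j, R i j
    · simp only [a, dif_pos h, Option.some.injEq]
      exact ⟨fun e => e ▸ h.choose_spec, fun hj => hfun _ _ _ h.choose_spec hj⟩
    · simp only [a, dif_neg h]
      exact ⟨fun e => by simp at e, fun hj => (h ⟨j, hj⟩).elim⟩
  have hub : ∀ i, M.buyerUtility p a i = u i := by
    intro i
    cases h : a i with
    | none =>
      rw [hu' i fun j hj => by simp [(ha i j).2 hj] at h]
      simp [buyerUtility, h]
    | some j => simp [buyerUtility, h, hu i j ((ha i j).1 h)]
  refine ⟨a, hp, ⟨fun i j h => hRg i j ((ha i j).1 h), fun i i' j h h' =>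
    hinj i i' j ((ha i j).1 h) ((ha i' j).1 h')⟩, ?_, ?_, ?_⟩
  · intro i j h
    rw [hub]
    exact hbest i j h
  · intro i
    rw [hub]
    exact hu0 i
  · exact fun j h => hunsold j fun i hi => h i ((ha i j).2 hi)

lemma IsCompetitiveEquilibrium.price_le_value {M : Market n m} {g : Fin n → Fin m → Prop}
    {p : Fin m → ℝ} {a : Fin n → Option (Fin m)} (h : M.IsCompetitiveEquilibrium g p a)
    {i : Fin n} {j : Fin m} (hij : a i = some j) : p j ≤ M.value i j := by
  have := h.utility_nonneg i
  simp only [buyerUtility, hij, Option.elim_some] at this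
  linarith

lemma IsCompetitiveEquilibrium.price_le_of_forall {M : Market n m} {g : Fin n → Fin m → Prop}
    {p : Fin m → ℝ} {a : Fin n → Option (Fin m)} (h : M.IsCompetitiveEquilibrium g p a)
    {j : Fin m} {C : ℝ} (hC : 0 ≤ C) (hv : ∀ i, a i = some j → g i j → p j ≤ C) : p j ≤ C := by
  by_cases hs : ∀ i, a i ≠ some j
  · rw [h.unsold j hs]
    exact hC
  · push Not at hs
    obtain ⟨i, hi⟩ := hs
    exact hv i hi (h.feasible.1 i j hi)

lemma price_nonneg (M : Market n m) (P : Finset (Fin m)) (j : Fin m) : 0 ≤ M.price P j := by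
  refine Real.sSup_nonneg ?_
  rintro _ ⟨p, ⟨a, h⟩, rfl⟩
  exact h.price_nonneg j

lemma price_le (M : Market n m) (P : Finset (Fin m)) (j : Fin m) {C : ℝ} (hC : 0 ≤ C)
    (h : ∀ p a, M.IsCompetitiveEquilibrium (M.linkWith P) p a → p j ≤ C) : M.price P j ≤ C := by
  refine Real.sSup_le ?_ hC
  rintro _ ⟨p, ⟨a, hp⟩, rfl⟩
  exact h p a hp

lemma price_le_of_value_le (M : Market n m) (P : Finset (Fin m)) (j : Fin m) {C : ℝ} (hC : 0 ≤ C)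
    (h : ∀ i, M.linkWith P i j → M.value i j ≤ C) : M.price P j ≤ C :=
  M.price_le P j hC fun _ _ hp => hp.price_le_of_forall hC fun i hi hg =>
    (hp.price_le_value hi).trans (h i hg)

lemma le_price (M : Market n m) (P : Finset (Fin m)) (j : Fin m) {p : Fin m → ℝ}
    (h : M.IsCompetitivePrice (M.linkWith P) p) : p j ≤ M.price P j := by
  -- A real `sSup` dominates its members only if the set is bounded; a sold good costs at most its
  -- buyer's value, an unsold one costs 0.
  refine le_csSup ⟨∑ i, M.value i j, ?_⟩ ⟨p, h, rfl⟩
  rintro _ ⟨q, ⟨a, hq⟩, rfl⟩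
  refine hq.price_le_of_forall (Finset.sum_nonneg fun i _ => M.value_nonneg i j) fun i hi _ =>
    (hq.price_le_value hi).trans ?_
  exact Finset.single_le_sum (f := fun i => M.value i j) (fun i _ => M.value_nonneg i j)
    (Finset.mem_univ i)

lemma welfare_le (M : Market n m) (g : Fin n → Fin m → Prop) (b : Fin n → ℝ) (hb : ∀ i, 0 ≤ b i)
    (h : ∀ i j, g i j → M.value i j ≤ b i) : M.welfare g ≤ ∑ i, b i := by
  refine Real.sSup_le ?_ (Finset.sum_nonneg fun i _ => hb i)
  rintro _ ⟨a, ha, rfl⟩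
  refine Finset.sum_le_sum fun i _ => ?_
  cases hi : a i with
  | none => simpa [allocValue, hi] using hb i
  | some j => simpa [allocValue, hi] using h i j (ha.1 i j hi)

lemma value_le_welfare (M : Market n m) (g : Fin n → Fin m → Prop) {i : Fin n} {j : Fin m}
    (h : g i j) : M.value i j ≤ M.welfare g := by
  classical
  refine le_csSup ⟨∑ i, ∑ j, M.value i j, ?_⟩
    ⟨fun k => if k = i then some j else none, ⟨?_, ?_⟩, ?_⟩
  · rintro _ ⟨a, ha, rfl⟩
    refine Finset.sum_le_sum fun i _ => ?_
    cases hi : a i with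
    | none => simpa [allocValue, hi] using Finset.sum_nonneg fun j _ => M.value_nonneg i j
    | some j =>
      simpa [allocValue, hi] using Finset.single_le_sum (f := fun j => M.value i j)
        (fun j _ => M.value_nonneg i j) (Finset.mem_univ j)
  · intro k l hkl
    dsimp only at hkl
    split_ifs at hkl with hk
    · obtain rfl : j = l := by simpa using hkl
      exact hk ▸ h
  · intro k k' l hk hk'
    by_cases h1 : k = i <;> by_cases h2 : k' = i <;> simp_all
  · rw [Finset.sum_eq_single i]
    · simp [allocValue]
    · intro k _ hk
      simp [allocValue, hk]
    · simp

/-! ### Expectations over independent joining decisions -/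

/-- The probability that exactly the sellers in `P` join. -/
noncomputable def joinWeight (x : Fin m → ℝ) (P : Finset (Fin m)) : ℝ :=
  (∏ j ∈ P, x j) * ∏ j ∈ Pᶜ, (1 - x j)

lemma expect_eq_sum (x : Fin m → ℝ) (f : Finset (Fin m) → ℝ) :
    expect x f = ∑ P, joinWeight x P * f P := rfl

lemma joinWeight_nonneg {x : Fin m → ℝ} (hx : ∀ j, x j ∈ Set.Icc (0 : ℝ) 1)
    (P : Finset (Fin m)) : 0 ≤ joinWeight x P :=
  mul_nonneg (Finset.prod_nonneg fun j _ => (hx j).1)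
    (Finset.prod_nonneg fun j _ => sub_nonneg.2 (hx j).2)

lemma sum_joinWeight (x : Fin m → ℝ) : ∑ P, joinWeight x P = 1 := by
  -- The weights are the terms of the expanded product of the factors `x j + (1 - x j) = 1`.
  have h := Fintype.prod_add x fun j => 1 - x j
  simp only [add_sub_cancel, Finset.prod_const_one] at h
  exact h.symm

lemma ne_zero_of_joinWeight {x : Fin m → ℝ} {P : Finset (Fin m)} (h : joinWeight x P ≠ 0)
    {j : Fin m} (hj : j ∈ P) : x j ≠ 0 := fun h0 =>
  h <| by rw [joinWeight, Finset.prod_eq_zero hj h0, zero_mul]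

lemma ne_one_of_joinWeight {x : Fin m → ℝ} {P : Finset (Fin m)} (h : joinWeight x P ≠ 0)
    {j : Fin m} (hj : j ∉ P) : x j ≠ 1 := fun h0 =>
  h <| by rw [joinWeight, Finset.prod_eq_zero (Finset.mem_compl.2 hj) (by simp [h0]), mul_zero]

lemma expect_le {x : Fin m → ℝ} (hx : ∀ j, x j ∈ Set.Icc (0 : ℝ) 1) {f : Finset (Fin m) → ℝ}
    {C : ℝ} (h : ∀ P, joinWeight x P ≠ 0 → f P ≤ C) : expect x f ≤ C := by
  calc expect x f ≤ ∑ P, joinWeight x P * C := by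
        rw [expect_eq_sum]
        refine Finset.sum_le_sum fun P _ => ?_
        by_cases h0 : joinWeight x P = 0
        · simp [h0]
        · exact mul_le_mul_of_nonneg_left (h P h0) (joinWeight_nonneg hx P)
    _ = C := by rw [← Finset.sum_mul, sum_joinWeight, one_mul]

lemma expect_neg (x : Fin m → ℝ) (f : Finset (Fin m) → ℝ) :
    expect x (fun P => -f P) = -expect x f := by
  simp [expect]

lemma le_expect {x : Fin m → ℝ} (hx : ∀ j, x j ∈ Set.Icc (0 : ℝ) 1) {f : Finset (Fin m) → ℝ}
    {C : ℝ} (h : ∀ P, joinWeight x P ≠ 0 → C ≤ f P) : C ≤ expect x f := by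
  have := expect_le hx (f := fun P => -f P) (C := -C) fun P hP => neg_le_neg (h P hP)
  rw [expect_neg] at this
  linarith

/-- If `f` is at most `C` on the support and `C` on average, it is `C` on the support. -/
lemma le_of_le_expect {x : Fin m → ℝ} (hx : ∀ j, x j ∈ Set.Icc (0 : ℝ) 1)
    {f : Finset (Fin m) → ℝ} {C : ℝ} (h : ∀ P, joinWeight x P ≠ 0 → f P ≤ C)
    (hC : C ≤ expect x f) {P : Finset (Fin m)} (hP : joinWeight x P ≠ 0) : C ≤ f P := by
  have hnn : ∀ Q ∈ Finset.univ, 0 ≤ joinWeight x Q * (C - f Q) := by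
    intro Q _
    by_cases h0 : joinWeight x Q = 0
    · simp [h0]
    · exact mul_nonneg (joinWeight_nonneg hx Q) (sub_nonneg.2 (h Q h0))
  have hs : ∑ Q, joinWeight x Q * (C - f Q) = C - expect x f := by
    simp only [mul_sub, Finset.sum_sub_distrib]
    rw [← Finset.sum_mul, sum_joinWeight, one_mul, expect_eq_sum]
  have h1 := Finset.single_le_sum hnn (Finset.mem_univ P)
  rw [hs] at h1
  have hpos := lt_of_le_of_ne (joinWeight_nonneg hx P) (Ne.symm hP)
  by_contra! hlt
  have := mul_pos hpos (sub_pos.2 hlt)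
  linarith

lemma joinWeight_update_of_notMem (x : Fin m → ℝ) {j : Fin m} {P : Finset (Fin m)} (hj : j ∉ P) :
    joinWeight x P = (1 - x j) * joinWeight (Function.update x j 0) P := by
  have hj' : j ∈ Pᶜ := Finset.mem_compl.2 hj
  rw [joinWeight, joinWeight, ← Finset.mul_prod_erase _ _ hj', ← Finset.mul_prod_erase _ _ hj',
    Finset.prod_congr rfl fun k hk => (Function.update_of_ne (ne_of_mem_of_not_mem hk hj) 0 x).symm,
    Finset.prod_congr (s₁ := (Pᶜ).erase j) rfl fun k hk => by
      rw [← Function.update_of_ne (Finset.ne_of_mem_erase hk) 0 x]]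
  simp only [Function.update_self]
  ring

lemma joinWeight_update_insert (x : Fin m → ℝ) {j : Fin m} {P : Finset (Fin m)} (hj : j ∉ P) :
    joinWeight x (insert j P) = x j * joinWeight (Function.update x j 0) P := by
  have hj' : j ∈ Pᶜ := Finset.mem_compl.2 hj
  rw [joinWeight, joinWeight, Finset.prod_insert hj, Finset.compl_insert,
    ← Finset.mul_prod_erase Pᶜ _ hj',
    Finset.prod_congr rfl fun k hk => (Function.update_of_ne (ne_of_mem_of_not_mem hk hj) 0 x).symm,
    Finset.prod_congr (s₁ := (Pᶜ).erase j) rfl fun k hk => by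
      rw [← Function.update_of_ne (Finset.ne_of_mem_erase hk) 0 x]]
  simp only [Function.update_self]
  ring

/-- Each set avoiding `j` is paired with the set obtained by adding `j`. -/
lemma sum_finset_eq_sum_notMem (j : Fin m) (F : Finset (Fin m) → ℝ) :
    ∑ P, F P = ∑ P with j ∉ P, (F P + F (insert j P)) := by
  rw [← Finset.sum_filter_add_sum_filter_not Finset.univ (fun P => j ∉ P), Finset.sum_add_distrib]
  congr 1
  refine Finset.sum_nbij' (fun P => P.erase j) (fun P => insert j P) ?_ ?_ ?_ ?_ ?_ <;>
    simp +contextual [Finset.insert_erase]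

/-- Conditioning the expectation on the decision of seller `j`. -/
lemma expect_eq_condition (x : Fin m → ℝ) (j : Fin m) (f : Finset (Fin m) → ℝ) :
    expect x f = (1 - x j) * expect (Function.update x j 0) f +
      x j * expect (Function.update x j 0) fun P => f (insert j P) := by
  have h0 : ∀ P, j ∈ P → joinWeight (Function.update x j 0) P = 0 := by
    intro P hP
    by_contra h
    exact ne_zero_of_joinWeight h hP (by simp)
  simp only [expect_eq_sum]
  rw [sum_finset_eq_sum_notMem j fun P => joinWeight x P * f P,
    sum_finset_eq_sum_notMem j fun P => joinWeight (Function.update x j 0) P * f P,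
    sum_finset_eq_sum_notMem j fun P => joinWeight (Function.update x j 0) P * f (insert j P),
    Finset.mul_sum, Finset.mul_sum, ← Finset.sum_add_distrib]
  refine Finset.sum_congr rfl fun P hP => ?_
  have hj : j ∉ P := by simpa using hP
  rw [joinWeight_update_insert x hj, joinWeight_update_of_notMem x hj,
    h0 (insert j P) (Finset.mem_insert_self j P)]
  ring

/-- Joining for sure with the sellers in `P`. -/
noncomputable def surely (P : Finset (Fin m)) (j : Fin m) : ℝ := by
  classical exact if j ∈ P then 1 else 0

lemma surely_mem (P : Finset (Fin m)) (j : Fin m) : surely P j ∈ Set.Icc (0 : ℝ) 1 := by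
  unfold surely
  split_ifs <;> simp

lemma expect_surely (P : Finset (Fin m)) (f : Finset (Fin m) → ℝ) :
    expect (surely P) f = f P := by
  have key : ∀ Q, joinWeight (surely P) Q ≠ 0 → Q = P := by
    intro Q hQ
    ext j
    have h1 := fun hj => ne_zero_of_joinWeight (j := j) hQ hj
    have h2 := fun hj => ne_one_of_joinWeight (j := j) hQ hj
    by_cases hP : j ∈ P <;> by_cases hQ' : j ∈ Q <;> simp_all [surely]
  exact le_antisymm (expect_le (surely_mem P) fun Q hQ => (congrArg f (key Q hQ)).le)
    (le_expect (surely_mem P) fun Q hQ => (congrArg f (key Q hQ)).ge)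

lemma update_surely (P : Finset (Fin m)) (j : Fin m) :
    Function.update (surely P) j 0 = surely (P.erase j) := by
  ext k
  by_cases hk : k = j
  · subst hk
    simp [surely]
  · simp [surely, hk]

/-! ### Incentives of a single seller in equilibrium -/

lemma IsPureEquilibrium.isMixedEquilibrium {M : Market n m} {α : ℝ} {P : Finset (Fin m)}
    (h : M.IsPureEquilibrium α P) : M.IsMixedEquilibrium α (surely P) := by
  refine ⟨surely_mem P, fun j => ?_⟩
  rw [update_surely, expect_surely, expect_surely, expect_surely]
  by_cases hj : j ∈ P
  · have := h.1 j hj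
    simp [sellerUtility, hj, Finset.insert_erase hj, this]
  · have := h.2 j hj
    simp [sellerUtility, hj, this]

lemma IsMixedEquilibrium.update_mem {M : Market n m} {α : ℝ} {x : Fin m → ℝ}
    (h : M.IsMixedEquilibrium α x) (j k : Fin m) :
    Function.update x j 0 k ∈ Set.Icc (0 : ℝ) 1 := by
  by_cases hk : k = j
  · subst hk
    simp
  · rw [Function.update_of_ne hk]
    exact h.1 k

lemma notMem_of_joinWeight_update {x : Fin m → ℝ} {j : Fin m} {P : Finset (Fin m)}
    (h : joinWeight (Function.update x j 0) P ≠ 0) : j ∉ P := fun hj =>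
  ne_zero_of_joinWeight h hj (by simp)

/-- A seller who joins with positive probability weakly gains by joining. -/
lemma IsMixedEquilibrium.off_le_on {M : Market n m} {α : ℝ} {x : Fin m → ℝ}
    (h : M.IsMixedEquilibrium α x) {j : Fin m} (hj : 0 < x j) {A B : ℝ}
    (hA : ∀ P, joinWeight (Function.update x j 0) P ≠ 0 → j ∉ P → A ≤ M.price P j)
    (hB : ∀ P, joinWeight (Function.update x j 0) P ≠ 0 → M.price (insert j P) j ≤ B)
    (hα : α ≤ 1) : A ≤ (1 - α) * B := by
  have h1 := (max_le_iff.1 (h.2 j)).1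
  rw [expect_eq_condition x j] at h1
  have h2 : A ≤ expect (Function.update x j 0) fun P => M.sellerUtility α P j :=
    le_expect (h.update_mem j) fun P hP => by
      have := notMem_of_joinWeight_update hP
      simpa [sellerUtility, this] using hA P hP this
  have h3 : expect (Function.update x j 0) (fun P => M.sellerUtility α (insert j P) j)
      ≤ (1 - α) * B :=
    expect_le (h.update_mem j) fun P hP => by
      simpa [sellerUtility] using mul_le_mul_of_nonneg_left (hB P hP) (sub_nonneg.2 hα)
  -- After conditioning, the equilibrium inequality reads `x j * off ≤ x j * on`, and `x j` is
  -- positive.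
  nlinarith

/-- A seller for whom joining is strictly better joins for sure. -/
lemma IsMixedEquilibrium.eq_one {M : Market n m} {α : ℝ} {x : Fin m → ℝ}
    (h : M.IsMixedEquilibrium α x) {j : Fin m} {A B : ℝ}
    (hA : ∀ P, joinWeight (Function.update x j 0) P ≠ 0 → j ∉ P → M.price P j ≤ A)
    (hB : ∀ P, joinWeight (Function.update x j 0) P ≠ 0 → B ≤ M.price (insert j P) j)
    (hα : α ≤ 1) (hAB : A < (1 - α) * B) : x j = 1 := by
  have h1 := (max_le_iff.1 (h.2 j)).2
  rw [expect_eq_condition x j] at h1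
  have h2 : (expect (Function.update x j 0) fun P => M.sellerUtility α P j) ≤ A :=
    expect_le (h.update_mem j) fun P hP => by
      have := notMem_of_joinWeight_update hP
      simpa [sellerUtility, this] using hA P hP this
  have h3 : (1 - α) * B ≤
      expect (Function.update x j 0) (fun P => M.sellerUtility α (insert j P) j) :=
    le_expect (h.update_mem j) fun P hP => by
      simpa [sellerUtility] using mul_le_mul_of_nonneg_left (hB P hP) (sub_nonneg.2 hα)
  refine le_antisymm (h.1 j).2 ?_
  by_contra! hlt
  nlinarith

end Market

/-! ### The ladder market and upper bounds on its prices -/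

/-- The small values `ε` and `δ j` that appear in the ladder market with `r` rungs. -/
structure LadderParams (r : ℕ) where
  ε : ℝ
  δ : ℕ → ℝ
  ε_pos : 0 < ε
  ε_le : 4 * (r * ε) ≤ 1
  one_le : 1 ≤ r
  δ_zero : δ 0 = 0
  δ_pos : ∀ j, 1 ≤ j → 0 < δ j
  δ_le : ∀ j, j < r → δ j ≤ ε / 2
  δ_gap : ∀ j k, j < k → k < r → 2 * r * δ j < ε * δ k

namespace LadderParams

variable {r n m : ℕ} (q : LadderParams r)

lemma δ_nonneg (j : ℕ) : 0 ≤ q.δ j := by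
  rcases Nat.eq_zero_or_pos j with rfl | h
  · exact q.δ_zero.ge
  · exact (q.δ_pos j h).le

lemma one_le_cast (q : LadderParams r) : (1 : ℝ) ≤ r := by exact_mod_cast q.one_le

lemma ε_le_quarter : q.ε ≤ 1 / 4 := by
  nlinarith [q.ε_le, q.ε_pos, q.one_le_cast]

/-- The difference in value between consecutive rungs of the ladder. -/
noncomputable def step : ℝ := 1 - r * q.ε

lemma step_ge : 3 / 4 ≤ q.step := by
  have := q.ε_le
  unfold step
  linarith

lemma step_le_one : q.step ≤ 1 := by
  have := mul_nonneg (Nat.cast_nonneg (α := ℝ) r) q.ε_pos.le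
  unfold step
  linarith

/-- The value of buyer `0` for good `j`. -/
noncomputable def top (j : ℕ) : ℝ := 1 + j * q.step

lemma one_le_top (j : ℕ) : 1 ≤ q.top j := by
  have := mul_nonneg (Nat.cast_nonneg (α := ℝ) j) (by linarith [q.step_ge] : 0 ≤ q.step)
  unfold top
  linarith

lemma step_le_top_sub {j k : ℕ} (h : j < k) : q.step ≤ q.top k - q.top j := by
  have h1 : (j : ℝ) + 1 ≤ k := by exact_mod_cast h
  have := q.step_ge
  unfold top
  nlinarith

lemma top_le {j : ℕ} (h : j < r) : q.top j ≤ r := by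
  have h1 : (j : ℝ) + 1 ≤ r := by exact_mod_cast h
  have := q.step_le_one
  unfold top
  nlinarith [Nat.cast_nonneg (α := ℝ) j]

/-- The ladder market: buyer `0` values good `j` at `top j`, buyer `j + 1` values good `j` at `ε`,
and seller `j ≥ 1` is linked to buyer `j` only, who values good `j` at `δ j`. -/
noncomputable def market (n m : ℕ) : Market n m where
  value i j := if (j : ℕ) < r then
      if (i : ℕ) = 0 then q.top j else if (i : ℕ) = j + 1 then q.ε
        else if (i : ℕ) = j then q.δ j else 0
    else 0
  value_nonneg i j := by
    have := q.δ_nonneg j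
    have := q.ε_pos
    have := q.one_le_top j
    split_ifs <;> linarith
  link i j := 1 ≤ (i : ℕ) ∧ (i : ℕ) = j ∧ (j : ℕ) < r

lemma value_eq (i : Fin n) (j : Fin m) : (q.market n m).value i j = if (j : ℕ) < r then
      if (i : ℕ) = 0 then q.top j else if (i : ℕ) = j + 1 then q.ε
        else if (i : ℕ) = j then q.δ j else 0
    else 0 := rfl

lemma linkWith_iff (P : Finset (Fin m)) (i : Fin n) (j : Fin m) :
    (q.market n m).linkWith P i j ↔ j ∈ P ∨ (1 ≤ (i : ℕ) ∧ (i : ℕ) = j ∧ (j : ℕ) < r) := Iff.rfl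

lemma value_le_ε {i : Fin n} (j : Fin m) (hi : (i : ℕ) ≠ 0) : (q.market n m).value i j ≤ q.ε := by
  have := q.ε_pos
  rw [value_eq]
  split_ifs with h1 h2
  · exact le_rfl
  · linarith [q.δ_le j h1]
  · exact this.le
  · exact this.le

lemma value_le_top (i : Fin n) (j : Fin m) : (q.market n m).value i j ≤ q.top j := by
  by_cases hi : (i : ℕ) = 0
  · have := q.one_le_top j
    rw [value_eq]
    split_ifs
    · exact le_rfl
    · linarith
  · linarith [q.value_le_ε j hi, q.ε_le_quarter, q.one_le_top j]

lemma value_eq_zero (i : Fin n) {j : Fin m} (hj : r ≤ j) : (q.market n m).value i j = 0 := by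
  rw [value_eq, if_neg (by omega)]

lemma price_le_top (P : Finset (Fin m)) (j : Fin m) : (q.market n m).price P j ≤ q.top j :=
  Market.price_le_of_value_le _ P j (by linarith [q.one_le_top j]) fun i _ => q.value_le_top i j

lemma price_of_le (P : Finset (Fin m)) {j : Fin m} (hj : r ≤ j) : (q.market n m).price P j = 0 :=
  le_antisymm (Market.price_le_of_value_le _ P j le_rfl fun i _ => (q.value_eq_zero i hj).le)
    (Market.price_nonneg _ P j)

lemma price_off_le {P : Finset (Fin m)} {j : Fin m} (hj : j ∉ P) :
    (q.market n m).price P j ≤ q.δ j := by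
  refine Market.price_le_of_value_le _ P j (q.δ_nonneg j) fun i hi => ?_
  obtain ⟨h1, h2, h3⟩ := ((q.linkWith_iff P i j).1 hi).resolve_left hj
  rw [value_eq, if_pos h3, if_neg (Nat.one_le_iff_ne_zero.1 h1), if_neg (by omega), if_pos h2]

/-- The prices of all but the highest seller on the platform are at most `ε`. -/
lemma competitivePrice_le_ε {P : Finset (Fin m)} {p : Fin m → ℝ} {a : Fin n → Option (Fin m)}
    (h : (q.market n m).IsCompetitiveEquilibrium ((q.market n m).linkWith P) p a)
    {j k : Fin m} (hk : k ∈ P) (hkr : (k : ℕ) < r) (hjk : j < k) : p j ≤ q.ε := by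
  refine h.price_le_of_forall q.ε_pos.le fun i hi _ => ?_
  by_cases hi0 : (i : ℕ) = 0
  -- If buyer 0 holds good `j`, then good `k` is unsold or held by a buyer valuing it at most `ε`,
  -- so its price is at most `ε`. Buyer 0 gains at least `step` in value by switching to `k`, so
  -- even then `j` cannot cost more than `ε`.
  · have hb := h.best i k (Or.inl hk)
    have hs := q.step_le_top_sub (Fin.lt_def.1 hjk)
    have hs' := q.step_ge
    have hq := q.ε_le_quarter
    simp only [Market.buyerUtility, hi, Option.elim_some, value_eq, if_pos hi0, if_pos hkr,
      if_pos (show (j : ℕ) < r by omega)] at hb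
    have hp : p k ≤ q.ε := by
      refine h.price_le_of_forall q.ε_pos.le fun i' hi' _ => ?_
      have hne : (i' : ℕ) ≠ 0 := by
        intro h0
        have : i' = i := Fin.ext (by omega)
        rw [this, hi] at hi'
        simp at hi'
        omega
      exact (h.price_le_value hi').trans (q.value_le_ε k hne)
    linarith
  · exact (h.price_le_value hi).trans (q.value_le_ε j hi0)

lemma price_le_ε {P : Finset (Fin m)} {j k : Fin m} (hk : k ∈ P) (hkr : (k : ℕ) < r)
    (hjk : j < k) : (q.market n m).price P j ≤ q.ε :=
  Market.price_le _ P j q.ε_pos.le fun _ _ h => q.competitivePrice_le_ε h hk hkr hjk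

/-- The next lower seller on the platform bounds the price of seller `k`. -/
lemma price_le_step_add_ε {P : Finset (Fin m)} {j k : Fin m} (hj : j ∈ P) (hk : k ∈ P)
    (hkr : (k : ℕ) < r) (hjk : (j : ℕ) + 1 = k) : (q.market n m).price P k ≤ q.step + q.ε := by
  have hs := q.step_ge
  have hq := q.ε_pos
  refine Market.price_le _ P k (by linarith) fun p a h =>
    h.price_le_of_forall (by linarith) fun i hi _ => ?_
  by_cases hi0 : (i : ℕ) = 0
  -- Buyer 0 could switch to good `j`, which costs at most `ε` and is worth only `step` less.
  · have hb := h.best i j (Or.inl hj)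
    have hp := q.competitivePrice_le_ε h hk hkr (j := j) (Fin.lt_def.2 (by omega))
    have hc : (k : ℝ) = j + 1 := by rw [← hjk, Nat.cast_add, Nat.cast_one]
    simp only [Market.buyerUtility, hi, Option.elim_some, value_eq, if_pos hi0, if_pos hkr,
      if_pos (show (j : ℕ) < r by omega), top, hc] at hb
    linarith
  · linarith [(h.price_le_value hi).trans (q.value_le_ε k hi0)]

/-! ### Explicit equilibria and lower bounds on prices -/

/-- Competitive prices when the sellers `P` join and `t` is the highest of them. -/
lemma exists_competitivePrice (hrn : r ≤ n) {P : Finset (Fin m)} {t : Fin m} (ht : (t : ℕ) < r)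
    {c : ℝ} (hc : q.ε ≤ c) (hct : c ≤ q.top t)
    (hcs : ∀ s ∈ P, s < t → c ≤ q.top t - q.top s) (hP : ∀ j ∈ P, (j : ℕ) < r → j ≤ t)
    (htP : t ∈ P ∨ ∀ j ∈ P, r ≤ (j : ℕ)) :
    ∃ p, (q.market n m).IsCompetitivePrice ((q.market n m).linkWith P) p ∧
      (∀ j ∈ P, j < t → p j = q.ε / 2) ∧ (t ∈ P → p t = c) ∧
      ∀ j, j ∉ P → t < j → (j : ℕ) < r → p j = q.δ j := by
  classical
  -- Buyer 0 buys `t` at price `c`, buyer `j + 1` buys each lower platform good `j` at `ε / 2`, and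
  -- an off-platform seller `j` sells to buyer `j` at `δ j`, unless that buyer is blocked, that is,
  -- already buys good `j - 1`; then good `j` stays unsold at price 0.
  let blocked : ℕ → Prop := fun i => ∃ j ∈ P, (j : ℕ) + 1 = i ∧ j < t
  have hblk : ∀ j : Fin m, j ∈ P → j < t → blocked (j + 1) := fun j h h' => ⟨j, h, rfl, h'⟩
  let p : Fin m → ℝ := fun j =>
    if j ∈ P then if j = t then c else if j < t then q.ε / 2 else 0
    else if 1 ≤ (j : ℕ) ∧ (j : ℕ) < r ∧ ¬ blocked j then q.δ j else 0
  let R : Fin n → Fin m → Prop := fun i j =>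
    ((i : ℕ) = 0 ∧ j = t ∧ t ∈ P) ∨ ((i : ℕ) = j + 1 ∧ j ∈ P ∧ j < t) ∨
      ((i : ℕ) = j ∧ 1 ≤ (j : ℕ) ∧ (j : ℕ) < r ∧ j ∉ P ∧ ¬ blocked j)
  let u : Fin n → ℝ := fun i =>
    if (i : ℕ) = 0 then if t ∈ P then q.top t - c else 0 else if blocked i then q.ε / 2 else 0
  have hε := q.ε_pos
  have htop : ∀ j ∈ P, (j : ℕ) < r → t ∈ P := fun j hj hjr =>
    htP.resolve_right fun h => by have := h j hj; omega
  have hp0 : ∀ j, 0 ≤ p j := by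
    intro j
    have := q.δ_nonneg j
    simp only [p]
    split_ifs <;> linarith
  have hu0 : ∀ i, 0 ≤ u i := by
    intro i
    simp only [u]
    split_ifs <;> linarith
  refine ⟨p, Market.isCompetitivePrice_of_matching _ _ R p u hp0 ?_ ?_ ?_ ?_ ?_ hu0 ?_ ?_,
    ?_, ?_, ?_⟩
  · rintro i j (⟨_, rfl, h⟩ | ⟨_, h, _⟩ | ⟨h, h1, h2, _, _⟩)
    · exact Or.inl h
    · exact Or.inl h
    · exact (q.linkWith_iff P i j).2 (Or.inr ⟨by omega, h, h2⟩)
  · rintro i j j' (⟨h, rfl, h'⟩ | ⟨h, h1, h2⟩ | ⟨h, h1, h2, h3, h4⟩)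
      (⟨k, k1, k'⟩ | ⟨k, k1, k2⟩ | ⟨k, k1, k2, k3, k4⟩) <;> try omega
    · exact (k4 ⟨j, h1, by omega, h2⟩).elim
    · exact (h4 ⟨j', k1, by omega, k2⟩).elim
  · rintro i i' j (⟨h, rfl, h'⟩ | ⟨h, h1, h2⟩ | ⟨h, h1, h2, h3, h4⟩)
      (⟨k, k1, k'⟩ | ⟨k, k1, k2⟩ | ⟨k, k1, k2, k3, k4⟩) <;> try omega
    · exact absurd h' k3
    · exact absurd h1 k3
    · exact absurd (k1 ▸ k') h3
    · exact absurd k1 h3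
  · rintro i j (⟨h, rfl, h'⟩ | ⟨h, h1, h2⟩ | ⟨h, h1, h2, h3, h4⟩)
    · simp [u, p, h, h', value_eq, ht]
    · have hb := hblk j h1 h2
      have hjt : j ≠ t := h2.ne
      have hjr : (j : ℕ) < r := by omega
      simp [u, p, h, h1, h2, hjt, hjr, hb, value_eq]
      ring
    · have h5 : (j : ℕ) ≠ 0 := by omega
      simp [u, p, h, h1, h2, h3, h4, h5, value_eq]
  · intro i hi
    simp only [u]
    split_ifs with h1 h2 h3
    · exact (hi t (Or.inl ⟨h1, rfl, h2⟩)).elim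
    · rfl
    · obtain ⟨j, hj, hj1, hj2⟩ := h3
      exact (hi j (Or.inr (Or.inl ⟨hj1.symm, hj, hj2⟩))).elim
    · rfl
  · intro i j hg
    rw [linkWith_iff] at hg
    rcases lt_or_ge (j : ℕ) r with hjr | hjr
    swap
    · rw [q.value_eq_zero i hjr]
      linarith [hp0 j, hu0 i]
    have hδ := q.δ_le j hjr
    have hδ0 := q.δ_nonneg j
    by_cases hj : j ∈ P
    · have htP' := htop j hj hjr
      have hjt := hP j hj hjr
      rcases hjt.eq_or_lt with rfl | hlt
      · have hpj : p j = c := by simp [p, hj]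
        have hui := hu0 i
        rw [hpj, value_eq, if_pos hjr]
        by_cases hi0 : (i : ℕ) = 0
        · simp [u, hi0, hj]
        · rw [if_neg hi0]
          split_ifs <;> linarith
      · have hpj : p j = q.ε / 2 := by simp [p, hj, hlt, hlt.ne]
        have hui := hu0 i
        rw [hpj, value_eq, if_pos hjr]
        by_cases hi0 : (i : ℕ) = 0
        · have hc' := hcs j hj hlt
          simp only [u, hi0, htP', if_true]
          linarith
        · rw [if_neg hi0]
          split_ifs with h1
          · have hb := hblk j hj hlt
            rw [← h1] at hb
            simp only [u, hi0, hb, if_true, if_false]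
            linarith
          · linarith
          · linarith
    · obtain ⟨h1, h2, _⟩ := hg.resolve_left hj
      have hi0 : (i : ℕ) ≠ 0 := by omega
      rw [value_eq, if_pos hjr, if_neg hi0, if_neg (by omega), if_pos h2]
      by_cases hb : blocked j
      -- A blocked buyer already has utility `ε / 2`, which is at least `δ j`, so even a free good
      -- `j` is no improvement.
      · have hb' : blocked i := h2 ▸ hb
        have := hp0 j
        simp only [u, hi0, hb', if_true, if_false]
        linarith
      · have hpj : p j = q.δ j := by
          simp only [p, hj, hb, if_false]
          rw [if_pos ⟨by omega, hjr, not_false⟩]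
        rw [hpj]
        linarith [hu0 i]
  · intro j hj
    simp only [p]
    split_ifs with h1 h2 h3 h4
    -- A good with nonzero price has its designated buyer; that buyer exists because indices stay
    -- below `r ≤ n`.
    · exact (hj ⟨0, by omega⟩ (Or.inl ⟨rfl, h2, h2 ▸ h1⟩)).elim
    · exact (hj ⟨j + 1, by omega⟩ (Or.inr (Or.inl ⟨rfl, h1, h3⟩))).elim
    · rfl
    · exact (hj ⟨j, by omega⟩ (Or.inr (Or.inr ⟨rfl, h4.1, h4.2.1, h1, h4.2.2⟩))).elim
    · rfl
  · intro j hj hjt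
    simp [p, hj, hjt, hjt.ne]
  · intro h
    simp [p, h]
  · intro j hj hjt hjr
    have hb : ¬ blocked j := by
      rintro ⟨k, _, hk, hk'⟩
      omega
    simp only [p, hj, hb, if_false]
    rw [if_pos ⟨by omega, hjr, not_false⟩]

end LadderParams

namespace LadderParams

variable {r n m : ℕ} (q : LadderParams r)

lemma le_price_of_highest (hrn : r ≤ n) {P : Finset (Fin m)} {t : Fin m} (htP : t ∈ P)
    (ht : (t : ℕ) < r) (hP : ∀ j ∈ P, (j : ℕ) < r → j ≤ t) :
    ∃ p, (q.market n m).IsCompetitivePrice ((q.market n m).linkWith P) p ∧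
      (∀ j ∈ P, j < t → p j = q.ε / 2) ∧ (t ∈ P → p t = 1 / 2) ∧
      ∀ j, j ∉ P → t < j → (j : ℕ) < r → p j = q.δ j := by
  -- Any constant between `ε ≤ 1 / 4` and `step ≥ 3 / 4` serves here.
  refine q.exists_competitivePrice hrn ht (c := 1 / 2) ?_ ?_ ?_ hP (Or.inl htP)
  · linarith [q.ε_le_quarter]
  · linarith [q.one_le_top t]
  · intro s _ hst
    linarith [q.step_le_top_sub (Fin.lt_def.1 hst), q.step_ge]

lemma exists_highest {P : Finset (Fin m)} {j : Fin m} (hj : j ∈ P) (hjr : (j : ℕ) < r) :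
    ∃ t ∈ P, (t : ℕ) < r ∧ ∀ j ∈ P, (j : ℕ) < r → j ≤ t := by
  obtain ⟨t, ht, hmax⟩ := (P.filter fun j : Fin m => (j : ℕ) < r).exists_max_image id
    ⟨j, Finset.mem_filter.2 ⟨hj, hjr⟩⟩
  rw [Finset.mem_filter] at ht
  exact ⟨t, ht.1, ht.2, fun j hj hjr => hmax j (Finset.mem_filter.2 ⟨hj, hjr⟩)⟩

lemma half_ε_le_price (hrn : r ≤ n) {P : Finset (Fin m)} {j : Fin m} (hj : j ∈ P)
    (hjr : (j : ℕ) < r) : q.ε / 2 ≤ (q.market n m).price P j := by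
  obtain ⟨t, htP, ht, hmax⟩ := exists_highest hj hjr
  obtain ⟨p, hp, h1, h2, -⟩ := q.le_price_of_highest hrn htP ht hmax
  refine le_trans ?_ (Market.le_price _ P j hp)
  rcases (hmax j hj hjr).eq_or_lt with rfl | hlt
  · rw [h2 hj]
    linarith [q.ε_le_quarter]
  · rw [h1 j hj hlt]

lemma δ_le_price_off (hrn : r ≤ n) {P : Finset (Fin m)} {k : Fin m} (hk : k ∉ P)
    (hk1 : 1 ≤ (k : ℕ)) (hkr : (k : ℕ) < r) (hP : ∀ j ∈ P, (j : ℕ) < r → j < k) :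
    q.δ k ≤ (q.market n m).price P k := by
  by_cases h : ∃ j ∈ P, (j : ℕ) < r
  · obtain ⟨j, hj, hjr⟩ := h
    obtain ⟨t, htP, ht, hmax⟩ := exists_highest hj hjr
    obtain ⟨p, hp, -, -, h3⟩ := q.le_price_of_highest hrn htP ht hmax
    rw [← h3 k hk (hP t htP ht) hkr]
    exact Market.le_price _ P k hp
  · push Not at h
    obtain ⟨p, hp, -, -, h3⟩ := q.exists_competitivePrice hrn (P := P)
      (t := ⟨0, by omega⟩) (show 0 < r by omega) (c := q.ε) le_rfl
      (by linarith [q.ε_le_quarter, q.one_le_top 0])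
      (fun s _ hs => absurd (Fin.lt_def.1 hs) (Nat.not_lt_zero _))
      (fun j hj hjr => absurd (h j hj) (by omega)) (Or.inr h)
    rw [← h3 k hk (Fin.lt_def.2 hk1) hkr]
    exact Market.le_price _ P k hp

/-! ### Equilibrium revenue -/

/-- Among the sellers on the ladder, exactly the lowest one is on the platform. -/
def LowestOnly (r : ℕ) (P : Finset (Fin m)) : Prop :=
  (∃ j ∈ P, (j : ℕ) = 0) ∧ ∀ j ∈ P, (j : ℕ) < r → (j : ℕ) = 0

lemma one_le_price_zero (hrn : r ≤ n) {P : Finset (Fin m)} {t : Fin m} (htP : t ∈ P)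
    (ht : (t : ℕ) = 0) (hP : ∀ j ∈ P, (j : ℕ) < r → (j : ℕ) = 0) :
    1 ≤ (q.market n m).price P t := by
  obtain ⟨p, hp, -, h2, -⟩ := q.exists_competitivePrice hrn (P := P) (t := t)
    (by have := q.one_le; omega) (c := 1) (by linarith [q.ε_le_quarter]) (q.one_le_top t)
    (fun s _ hs => absurd (Fin.lt_def.1 hs) (by omega))
    (fun j hj hjr => Fin.le_def.2 (by have := hP j hj hjr; omega)) (Or.inl htP)
  rw [← h2 htP]
  exact Market.le_price _ P t hp

lemma sum_price_eq_zero {P : Finset (Fin m)} (h : ∀ j ∈ P, r ≤ (j : ℕ)) :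
    ∑ j ∈ P, (q.market n m).price P j = 0 :=
  Finset.sum_eq_zero fun j hj => q.price_of_le P (h j hj)

lemma sum_price_le_one {P : Finset (Fin m)} {k : Fin m} (hk : k ∈ P) (hkr : (k : ℕ) < r)
    (hP : ∀ j ∈ P, (j : ℕ) < r → j ≤ k) (hpred : 1 ≤ (k : ℕ) → ∃ j ∈ P, (j : ℕ) + 1 = k) :
    ∑ j ∈ P, (q.market n m).price P j ≤ 1 := by
  rcases Nat.eq_zero_or_pos (k : ℕ) with h0 | h0
  · rw [Finset.sum_eq_single k]
    · have := q.price_le_top (n := n) P k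
      simpa [top, h0] using this
    · intro j hj hjk
      refine q.price_of_le P ?_
      by_contra! hlt
      have := hP j hj hlt
      omega
    · exact fun h => absurd hk h
  · obtain ⟨l, hl, hlk⟩ := hpred h0
    have hε := q.ε_pos
    have hs := q.step_ge
    calc ∑ j ∈ P, (q.market n m).price P j
        -- Every ladder seller is charged `ε`, the highest one `step` in addition; goods beyond the
        -- ladder are worthless.
        ≤ ∑ j ∈ P, ((if (j : ℕ) < r then q.ε else 0) + if j = k then q.step else 0) := by
          refine Finset.sum_le_sum fun j hj => ?_
          by_cases hjr : (j : ℕ) < r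
          · rcases (hP j hj hjr).eq_or_lt with rfl | hlt
            · have := q.price_le_step_add_ε (n := n) hl hj hjr hlk
              simp only [hjr, if_true]
              linarith
            · have := q.price_le_ε (n := n) hk hkr hlt
              simpa [hjr, hlt.ne] using this
          · rw [q.price_of_le P (by omega)]
            split_ifs <;> linarith
      _ ≤ ∑ j : Fin m, ((if (j : ℕ) < r then q.ε else 0) + if j = k then q.step else 0) := by
          refine Finset.sum_le_sum_of_subset_of_nonneg (Finset.subset_univ P) fun j _ _ => ?_
          split_ifs <;> linarith
      _ ≤ r * q.ε + q.step := by
          rw [Finset.sum_add_distrib, ← Finset.sum_filter, Finset.sum_const, nsmul_eq_mul]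
          simp only [Finset.sum_ite_eq', Finset.mem_univ, if_true]
          gcongr
          rw [Fin.card_filter_val_lt]
          exact min_le_right _ _
      _ = 1 := by
          unfold step
          ring

/-- If seller `k` is the highest to join with positive probability, all lower ones join surely. -/
lemma eq_one_of_highest (hrn : r ≤ n) {α : ℝ} {x : Fin m → ℝ}
    (h : (q.market n m).IsMixedEquilibrium α x) (hα : α ≤ 1) {k : Fin m} (hk1 : 1 ≤ (k : ℕ))
    (hkr : (k : ℕ) < r) (hk : 0 < x k) (hmax : ∀ j : Fin m, k < j → (j : ℕ) < r → x j = 0) :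
    α < 1 ∧ ∀ j, j < k → x j = 1 := by
  have hr := q.one_le_cast
  -- With nobody above `k` on the platform, buyer `k + 1` plays no role and buyer `k` is not needed
  -- elsewhere in the constructed equilibrium, so staying off secures `δ k`; joining yields a price
  -- of at most `top k ≤ r`.
  have hoff : q.δ k ≤ (1 - α) * r := by
    refine h.off_le_on hk (fun P hP hkP => q.δ_le_price_off hrn hkP hk1 hkr fun j hj hjr => ?_)
      (fun P _ => (q.price_le_top _ k).trans (q.top_le hkr)) hα
    have hjk : j ≠ k := ne_of_mem_of_not_mem hj hkP
    have hxj := Market.ne_zero_of_joinWeight hP hj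
    rw [Function.update_of_ne hjk] at hxj
    by_contra hlt
    exact hxj (hmax j (by omega) hjr)
  have hδ := q.δ_pos k hk1
  refine ⟨by nlinarith, fun j hj => ?_⟩
  have hjk := Fin.lt_def.1 hj
  refine h.eq_one (fun P _ hjP => q.price_off_le hjP) (fun P _ => q.half_ε_le_price hrn
    (Finset.mem_insert_self j P) (by omega)) hα ?_
  -- With `hoff`, the gap `2 * r * δ j < ε * δ k` gives `δ j < (1 - α) * (ε / 2)`, so joining is
  -- strictly better for `j`.
  have hg := q.δ_gap j k hjk hkr
  have : q.ε * q.δ k ≤ q.ε * ((1 - α) * r) := mul_le_mul_of_nonneg_left hoff q.ε_pos.le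
  nlinarith

lemma sum_price_le_one_of_highest (hrn : r ≤ n) {α : ℝ} {x : Fin m → ℝ}
    (h : (q.market n m).IsMixedEquilibrium α x) (hα : α ≤ 1) {k : Fin m} (hk1 : 1 ≤ (k : ℕ))
    (hkr : (k : ℕ) < r) (hk : 0 < x k) (hmax : ∀ j : Fin m, k < j → (j : ℕ) < r → x j = 0)
    {P : Finset (Fin m)} (hP : Market.joinWeight x P ≠ 0) :
    ∑ j ∈ P, (q.market n m).price P j ≤ 1 := by
  have hone := (q.eq_one_of_highest hrn h hα hk1 hkr hk hmax).2
  have hmem : ∀ j, j < k → j ∈ P := fun j hj => by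
    by_contra hjP
    exact Market.ne_one_of_joinWeight hP hjP (hone j hj)
  have hle : ∀ j ∈ P, (j : ℕ) < r → j ≤ k := fun j hj hjr => by
    by_contra! hlt
    exact Market.ne_zero_of_joinWeight hP hj (hmax j hlt hjr)
  -- Seller `k` may randomize; if absent, `k - 1` is the highest one present, and the sellers below
  -- it are still all there.
  by_cases hkP : k ∈ P
  · refine q.sum_price_le_one hkP hkr hle fun _ => ⟨⟨k - 1, by omega⟩, hmem _ ?_, ?_⟩
    · exact Fin.lt_def.2 (by simp; omega)
    · simp; omega
  · refine q.sum_price_le_one (k := ⟨k - 1, by omega⟩) (hmem _ (Fin.lt_def.2 (by simp; omega)))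
      (by simp; omega) (fun j hj hjr => ?_) fun h1 => ⟨⟨k - 2, by omega⟩, hmem _ ?_, ?_⟩
    · have h1 := hle j hj hjr
      have h2 : j ≠ k := ne_of_mem_of_not_mem hj hkP
      exact Fin.le_def.2 (by simp; omega)
    · exact Fin.lt_def.2 (by simp; omega)
    · simp at h1 ⊢; omega

/-- No mixed equilibrium has revenue above `1`, and it is `1` only if no seller above the lowest
one joins. -/
lemma mixed_revenue (hrn : r ≤ n) {α : ℝ} {x : Fin m → ℝ}
    (h : (q.market n m).IsMixedEquilibrium α x) (hα : α ∈ Set.Icc (0 : ℝ) 1) :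
    Market.expect x ((q.market n m).revenue α) ≤ 1 ∧
      (1 ≤ Market.expect x ((q.market n m).revenue α) →
        ∀ P, Market.joinWeight x P ≠ 0 → LowestOnly r P) := by
  by_cases hk : ∃ k : Fin m, 1 ≤ (k : ℕ) ∧ (k : ℕ) < r ∧ 0 < x k
  · obtain ⟨k', hk'⟩ := hk
    obtain ⟨k, hk, hmax⟩ := (Finset.univ.filter fun k : Fin m =>
      1 ≤ (k : ℕ) ∧ (k : ℕ) < r ∧ 0 < x k).exists_max_image id
      ⟨k', Finset.mem_filter.2 ⟨Finset.mem_univ _, hk'⟩⟩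
    obtain ⟨-, hk1, hkr, hk0⟩ := Finset.mem_filter.1 hk
    have hmax' : ∀ j : Fin m, k < j → (j : ℕ) < r → x j = 0 := by
      intro j hj hjr
      refine le_antisymm ?_ (h.1 j).1
      by_contra! hpos
      have : j ≤ k := hmax j (Finset.mem_filter.2 ⟨Finset.mem_univ _, by omega, hjr, hpos⟩)
      omega
    have hlt := (q.eq_one_of_highest hrn h hα.2 hk1 hkr hk0 hmax').1
    have hle : Market.expect x ((q.market n m).revenue α) ≤ α := by
      refine Market.expect_le h.1 fun P hP => ?_
      have := q.sum_price_le_one_of_highest hrn h hα.2 hk1 hkr hk0 hmax' hP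
      exact mul_le_of_le_one_right hα.1 this
    -- Revenue is at most the fee, which is strictly below 1, so this case never attains 1.
    exact ⟨hle.trans hα.2, fun h1 => absurd (h1.trans hle) (not_le.2 hlt)⟩
  · push Not at hk
    have hlow : ∀ P, Market.joinWeight x P ≠ 0 → ∀ j ∈ P, (j : ℕ) < r → (j : ℕ) = 0 := by
      intro P hP j hj hjr
      by_contra h0
      exact Market.ne_zero_of_joinWeight hP hj (le_antisymm (hk j (by omega) hjr) (h.1 j).1)
    have hrev0 : ∀ P, Market.joinWeight x P ≠ 0 → (¬ ∃ j ∈ P, (j : ℕ) = 0) →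
        (q.market n m).revenue α P = 0 := by
      intro P hP h0
      rw [Market.revenue, q.sum_price_eq_zero, mul_zero]
      intro j hj
      by_contra! hjr
      exact h0 ⟨j, hj, hlow P hP j hj hjr⟩
    have hrev : ∀ P, Market.joinWeight x P ≠ 0 → (q.market n m).revenue α P ≤ 1 := by
      intro P hP
      by_cases h0 : ∃ j ∈ P, (j : ℕ) = 0
      · obtain ⟨j, hj, hj0⟩ := h0
        have := q.sum_price_le_one (n := n) hj (by have := q.one_le; omega)
          (fun l hl hlr => Fin.le_def.2 (by have := hlow P hP l hl hlr; omega)) fun h => by omega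
        exact (mul_le_of_le_one_right hα.1 this).trans hα.2
      · rw [hrev0 P hP h0]
        exact zero_le_one
    refine ⟨Market.expect_le h.1 hrev, fun h1 P hP => ⟨?_, hlow P hP⟩⟩
    by_contra h0
    -- An average of 1 with all outcomes at most 1 forces revenue 1 on the whole support, excluding
    -- sets without seller 0.
    have := Market.le_of_le_expect h.1 hrev h1 hP
    rw [hrev0 P hP h0] at this
    linarith

/-- At fee 1 joining pays nothing to anyone, and seller 0 loses nothing by it since `δ 0 = 0`. -/
lemma isPureEquilibrium_singleton {z : Fin m} (hz : (z : ℕ) = 0) :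
    (q.market n m).IsPureEquilibrium 1 {z} := by
  refine ⟨fun j hj => ?_, fun j _ => ?_⟩
  · obtain rfl := Finset.mem_singleton.1 hj
    have := q.price_off_le (n := n) (Finset.notMem_erase j {j})
    rw [hz, q.δ_zero] at this
    simpa using this
  · simpa using Market.price_nonneg _ _ j

lemma one_le_revenue_singleton (hrn : r ≤ n) {z : Fin m} (hz : (z : ℕ) = 0) :
    1 ≤ (q.market n m).revenue 1 {z} := by
  have := q.one_le_price_zero hrn (Finset.mem_singleton_self z) hz fun j hj _ => by
    rw [Finset.mem_singleton.1 hj, hz]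
  simpa [Market.revenue] using this

lemma pure_revenue_le (hrn : r ≤ n) {α : ℝ} {P : Finset (Fin m)}
    (h : (q.market n m).IsPureEquilibrium α P) (hα : α ∈ Set.Icc (0 : ℝ) 1) :
    (q.market n m).revenue α P ≤ 1 := by
  have := (q.mixed_revenue hrn h.isMixedEquilibrium hα).1
  rwa [Market.expect_surely] at this

lemma isPureOptimal_singleton (hrn : r ≤ n) {z : Fin m} (hz : (z : ℕ) = 0) :
    (q.market n m).IsPureOptimal 1 {z} :=
  ⟨by simp, q.isPureEquilibrium_singleton hz, fun _ hβ _ hQ =>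
    (q.pure_revenue_le hrn hQ hβ).trans (q.one_le_revenue_singleton hrn hz)⟩

lemma isMixedOptimal_singleton (hrn : r ≤ n) {z : Fin m} (hz : (z : ℕ) = 0) :
    (q.market n m).IsMixedOptimal 1 (Market.surely {z}) := by
  refine ⟨by simp, (q.isPureEquilibrium_singleton hz).isMixedEquilibrium, fun β hβ y hy => ?_⟩
  rw [Market.expect_surely]
  exact (q.mixed_revenue hrn hy hβ).1.trans (q.one_le_revenue_singleton hrn hz)

lemma lowestOnly_of_isMixedOptimal (hrn : r ≤ n) (hm : 0 < m) {α : ℝ} {x : Fin m → ℝ}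
    (h : (q.market n m).IsMixedOptimal α x) {P : Finset (Fin m)}
    (hP : Market.joinWeight x P ≠ 0) : LowestOnly r P := by
  refine (q.mixed_revenue hrn h.2.1 h.1).2 ?_ P hP
  have hz : ((⟨0, hm⟩ : Fin m) : ℕ) = 0 := rfl
  have := h.2.2 1 (by simp) _ (q.isPureEquilibrium_singleton hz).isMixedEquilibrium
  rw [Market.expect_surely] at this
  exact (q.one_le_revenue_singleton hrn hz).trans this

lemma lowestOnly_of_isPureOptimal (hrn : r ≤ n) (hm : 0 < m) {α : ℝ} {P : Finset (Fin m)}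
    (h : (q.market n m).IsPureOptimal α P) : LowestOnly r P := by
  have hz : ((⟨0, hm⟩ : Fin m) : ℕ) = 0 := rfl
  have h1 := h.2.2 1 (by simp) _ (q.isPureEquilibrium_singleton hz)
  refine (q.mixed_revenue hrn h.2.1.isMixedEquilibrium h.1).2 ?_ P ?_
  · rw [Market.expect_surely]
    exact (q.one_le_revenue_singleton hrn hz).trans h1
  -- The expectation of the indicator of `P` is the weight of `P`, here 1.
  · have := Market.expect_surely P fun Q => if Q = P then (1 : ℝ) else 0
    simp only [Market.expect_eq_sum, mul_ite, mul_one, mul_zero, Finset.sum_ite_eq',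
      Finset.mem_univ, if_true] at this
    rw [this]
    exact one_ne_zero

/-! ### Welfare and two-sided bounds on the prices of anarchy -/

lemma sum_bound (c : ℝ) (hc : 0 ≤ c) :
    ∑ i : Fin n, (if (i : ℕ) = 0 then c else q.ε) ≤ c + n * q.ε := by
  have hε := q.ε_pos
  calc ∑ i : Fin n, (if (i : ℕ) = 0 then c else q.ε)
      ≤ ∑ i : Fin n, ((if (i : ℕ) = 0 then c else 0) + q.ε) := by
        refine Finset.sum_le_sum fun i _ => ?_
        split_ifs <;> linarith
    _ ≤ c + n * q.ε := by
        rw [Finset.sum_add_distrib, Finset.sum_const, Finset.card_univ, Fintype.card_fin,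
          nsmul_eq_mul]
        gcongr
        cases n with
        | zero => simpa using hc
        | succ n => simp

lemma welfare_le_of_value_zero (g : Fin n → Fin m → Prop) (c : ℝ) (hc : 0 ≤ c)
    (h : ∀ i j, g i j → (i : ℕ) = 0 → (q.market n m).value i j ≤ c) :
    (q.market n m).welfare g ≤ c + n * q.ε := by
  refine (Market.welfare_le _ g (fun i => if (i : ℕ) = 0 then c else q.ε) ?_ ?_).trans
    (q.sum_bound c hc)
  · intro i
    have := q.ε_pos
    split_ifs <;> linarith
  · intro i j hij
    split_ifs with h0
    · exact h i j hij h0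
    · exact q.value_le_ε j h0

lemma one_le_welfare (hrn : r ≤ n) {P : Finset (Fin m)} (h : LowestOnly r P) :
    1 ≤ (q.market n m).welfare ((q.market n m).linkWith P) := by
  obtain ⟨⟨j, hj, hj0⟩, -⟩ := h
  have hr := q.one_le
  have := Market.value_le_welfare (q.market n m) ((q.market n m).linkWith P)
    (i := ⟨0, by omega⟩) (j := j) (Or.inl hj)
  rw [value_eq, if_pos (by omega), if_pos rfl] at this
  exact (q.one_le_top j).trans this

lemma welfare_le_one_add {P : Finset (Fin m)} (h : LowestOnly r P) :
    (q.market n m).welfare ((q.market n m).linkWith P) ≤ 1 + n * q.ε := by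
  refine q.welfare_le_of_value_zero _ 1 zero_le_one fun i j hij hi => ?_
  rw [value_eq]
  split_ifs with hjr
  · have hjP := ((q.linkWith_iff P i j).1 hij).resolve_right (by omega)
    simp [h.2 j hjP hjr, top]
  · exact zero_le_one

lemma top_le_optimalWelfare (hrn : r ≤ n) (hrm : r ≤ m) :
    q.top (r - 1) ≤ (q.market n m).optimalWelfare := by
  have hr := q.one_le
  have := Market.value_le_welfare (q.market n m) (fun _ _ => True)
    (i := ⟨0, by omega⟩) (j := ⟨r - 1, by omega⟩) trivial
  rwa [value_eq, if_pos (by simp; omega), if_pos rfl] at this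

lemma optimalWelfare_le : (q.market n m).optimalWelfare ≤ q.top (r - 1) + n * q.ε := by
  have h1 := q.one_le_top (r - 1)
  refine q.welfare_le_of_value_zero _ _ (by linarith) fun i j _ hi => ?_
  rw [value_eq]
  split_ifs with hjr
  · rcases (show (j : ℕ) ≤ r - 1 by omega).eq_or_lt with h | h
    · rw [h]
    · linarith [q.step_le_top_sub h, q.step_ge]
  · linarith

lemma ratio_le {w : ℝ} (hw : 1 ≤ w) :
    ENNReal.ofReal (q.market n m).optimalWelfare / ENNReal.ofReal w ≤
      ENNReal.ofReal (q.top (r - 1) + n * q.ε) := by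
  refine (ENNReal.div_le_div (ENNReal.ofReal_le_ofReal q.optimalWelfare_le)
    (ENNReal.one_le_ofReal.2 hw)).trans ?_
  rw [div_one]

lemma le_ratio (hrn : r ≤ n) (hrm : r ≤ m) {w : ℝ} (hw : w ≤ 1 + n * q.ε) :
    ENNReal.ofReal (q.top (r - 1) / (1 + n * q.ε)) ≤
      ENNReal.ofReal (q.market n m).optimalWelfare / ENNReal.ofReal w := by
  have := q.ε_pos
  rw [ENNReal.ofReal_div_of_pos (by positivity)]
  exact ENNReal.div_le_div (ENNReal.ofReal_le_ofReal (q.top_le_optimalWelfare hrn hrm))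
    (ENNReal.ofReal_le_ofReal hw)

lemma purePoA_mem (hrn : r ≤ n) (hrm : r ≤ m) : (q.market n m).purePoA ∈
    Set.Icc (ENNReal.ofReal (q.top (r - 1) / (1 + n * q.ε)))
      (ENNReal.ofReal (q.top (r - 1) + n * q.ε)) := by
  have hm : 0 < m := q.one_le.trans hrm
  constructor
  · have h := q.isPureOptimal_singleton (m := m) hrn (z := ⟨0, hm⟩) rfl
    refine (q.le_ratio hrn hrm (q.welfare_le_one_add
      (q.lowestOnly_of_isPureOptimal hrn hm h))).trans ?_
    exact le_iSup_of_le 1 (le_iSup_of_le _ (le_iSup_of_le h le_rfl))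
  · exact iSup_le fun α => iSup_le fun P => iSup_le fun h =>
      q.ratio_le (q.one_le_welfare hrn (q.lowestOnly_of_isPureOptimal hrn hm h))

lemma mixedPoA_mem (hrn : r ≤ n) (hrm : r ≤ m) : (q.market n m).mixedPoA ∈
    Set.Icc (ENNReal.ofReal (q.top (r - 1) / (1 + n * q.ε)))
      (ENNReal.ofReal (q.top (r - 1) + n * q.ε)) := by
  have hm : 0 < m := q.one_le.trans hrm
  constructor
  · have h := q.isMixedOptimal_singleton (m := m) hrn (z := ⟨0, hm⟩) rfl
    refine (q.le_ratio hrn hrm (Market.expect_le h.2.1.1 fun P hP => q.welfare_le_one_add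
      (q.lowestOnly_of_isMixedOptimal hrn hm h hP))).trans ?_
    exact le_iSup_of_le 1 (le_iSup_of_le _ (le_iSup_of_le h le_rfl))
  · exact iSup_le fun α => iSup_le fun x => iSup_le fun h =>
      q.ratio_le (Market.le_expect h.2.1.1 fun P hP =>
        q.one_le_welfare hrn (q.lowestOnly_of_isMixedOptimal hrn hm h hP))

/-! ### Choice of parameters and the limit -/

lemma exists_ε_eq {r : ℕ} (hr : 1 ≤ r) {e : ℝ} (he : 0 < e) (her : 4 * (r * e) ≤ 1) :
    ∃ q : LadderParams r, q.ε = e := by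
  have hr' : (1 : ℝ) ≤ r := by exact_mod_cast hr
  -- The `δ j` with `j ≥ 1` grow geometrically with ratio `1 / l` up to `δ (r - 1) = e * l`. As `4 *
  -- r * l = e`, one rung down gives `2 * r * δ j = e * δ k / 2`, half of what the gap allows.
  obtain ⟨l, hl⟩ : ∃ l, l = e / (4 * r) := ⟨_, rfl⟩
  have hl0 : 0 < l := by rw [hl]; positivity
  have hle : l * (4 * r) = e := by rw [hl]; field_simp
  have hl1 : l ≤ 1 / 2 := by nlinarith
  refine ⟨⟨e, fun j => if j = 0 then 0 else e * l ^ (r - j), he, her, hr, rfl, ?_, ?_, ?_⟩, rfl⟩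
  · intro j hj
    rw [if_neg (by omega)]
    positivity
  · intro j hj
    split_ifs
    · positivity
    · have : l ^ (r - j) ≤ l ^ 1 := pow_le_pow_of_le_one hl0.le (by linarith) (by omega)
      rw [pow_one] at this
      nlinarith
  · intro j k hjk hk
    rw [if_neg (show k ≠ 0 by omega)]
    have hpow : 0 < l ^ (r - k) := by positivity
    split_ifs
    · rw [mul_zero]
      positivity
    · have h1 : l ^ (r - j) ≤ l ^ (r - k + 1) :=
        pow_le_pow_of_le_one hl0.le (by linarith) (by omega)
      calc 2 * r * (e * l ^ (r - j)) ≤ 2 * r * (e * l ^ (r - k + 1)) := by gcongr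
        _ = e * (e * l ^ (r - k)) / 2 := by
            rw [← hle]
            ring
        _ < e * (e * l ^ (r - k)) := half_lt_self (by positivity)

end LadderParams

theorem mainTheorem9 (n m : ℕ) (hn : 1 ≤ n) (hm : 1 ≤ m) :
    ∃ M : ℕ → Market n m,
      Tendsto (fun k => (M k).purePoA) atTop (𝓝 ((min n m : ℕ) : ℝ≥0∞)) ∧
        Tendsto (fun k => (M k).mixedPoA) atTop (𝓝 ((min n m : ℕ) : ℝ≥0∞)) := by
  have hr : 1 ≤ min n m := le_min hn hm
  have hrn : min n m ≤ n := min_le_left n m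
  have hrm : min n m ≤ m := min_le_right n m
  generalize min n m = r at *
  have hr' : (1 : ℝ) ≤ r := by exact_mod_cast hr
  -- Any null sequence respecting `4 * (r * ε) ≤ 1` would do.
  have hq : ∀ k : ℕ, ∃ q : LadderParams r, q.ε = 1 / (4 * r) * (1 / ((k : ℝ) + 1)) := by
    intro k
    refine LadderParams.exists_ε_eq hr (by positivity) ?_
    have h1 : 1 / ((k : ℝ) + 1) ≤ 1 := by
      rw [div_le_one (by positivity)]
      linarith [Nat.cast_nonneg (α := ℝ) k]
    calc 4 * (r * (1 / (4 * r) * (1 / ((k : ℝ) + 1)))) = 1 / ((k : ℝ) + 1) := by field_simp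
      _ ≤ 1 := h1
  choose q hqe using hq
  have hε : Tendsto (fun k => (q k).ε) atTop (𝓝 0) := by
    simp only [hqe]
    simpa using tendsto_one_div_add_atTop_nhds_zero_nat.const_mul (1 / (4 * (r : ℝ)))
  have hr1 : ((r - 1 : ℕ) : ℝ) = r - 1 := by rw [Nat.cast_sub hr, Nat.cast_one]
  have htop : Tendsto (fun k => (q k).top (r - 1)) atTop (𝓝 r) := by
    have := ((hε.const_mul (r : ℝ)).const_sub 1).const_mul ((r : ℝ) - 1) |>.const_add 1
    simpa [LadderParams.top, LadderParams.step, hr1] using this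
  have hnε : Tendsto (fun k => (n : ℝ) * (q k).ε) atTop (𝓝 0) := by
    simpa using hε.const_mul (n : ℝ)
  have hlow : Tendsto (fun k => ENNReal.ofReal ((q k).top (r - 1) / (1 + n * (q k).ε))) atTop
      (𝓝 (r : ℝ≥0∞)) := by
    have := ENNReal.tendsto_ofReal (htop.div (hnε.const_add 1) (by norm_num))
    simpa using this
  have hup : Tendsto (fun k => ENNReal.ofReal ((q k).top (r - 1) + n * (q k).ε)) atTop
      (𝓝 (r : ℝ≥0∞)) := by
    have := ENNReal.tendsto_ofReal (htop.add hnε)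
    simpa using this
  exact ⟨fun k => (q k).market n m,
    tendsto_of_tendsto_of_tendsto_of_le_of_le hlow hup
      (fun k => ((q k).purePoA_mem hrn hrm).1) fun k => ((q k).purePoA_mem hrn hrm).2,
    tendsto_of_tendsto_of_tendsto_of_le_of_le hlow hup
      (fun k => ((q k).mixedPoA_mem hrn hrm).1) fun k => ((q k).mixedPoA_mem hrn hrm).2⟩
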